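/- Let $G$ be a finite simple connected graph of order $n$ with minimum degree $\delta$ and girth $g\ge 3$ (the length of a shortest cycle), and let $k$ be an integer with $\delta\ge k\ge 2$. Let $q(G)$ be the largest eigenvalue of the signless Laplacian matrix $Q(G)=D(G)+A(G)$, where $D(G)$ is the diagonal matrix of vertex degrees and $A(G)$ the adjacency matrix. Put $t=\lfloor (g-1)/2\rfloor$, and for a positive integer $\kappa$ let $$\nu(\delta,g,\kappa)=\begin{cases}1+(\delta-\kappa)\sum_{i=0}^{t-1}(\delta-1)^i & \text{if } g=2t+1,\\ 2+(2\delta-2-\kappa)\sum_{i=0}^{t-1}(\delta-1)^i & \text{if } g=2t+2 \text{ and } \delta\ge 3,\\ 2t+1 & \text{if } g=2t+2 \text{ and } \delta=2.\end{cases}$$ Let $\nu=\nu(\delta,g,k-1)$. If $$q(G)\ \ge\ \begin{cases}\dfrac{(\nu+k-1)^{1+\frac1t}+(n-\nu)^{1+\frac1t}}{n-1}+\dfrac{k}{n-1}+(n-1) & \text{if } g=2t+1,\\[2ex] \dfrac{(\nu+k-1)^{1+\frac1t}+(n-\nu)^{1+\frac1t}}{2^{1/t}(n-1)}+\dfrac{k}{n-1}+(n-1)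 & \text{if } g=2t+2,\end{cases}$$ then $G$ is $k$-connected, that is, $\kappa(G)\ge k$, where $\kappa(G)$ is the minimum size of a set $C$ of vertices such that $G-C$ is disconnected or is a single vertex. -/

import Mathlib

namespace SimpleGraph

/-- A set `C` of vertices is a vertex-cut of `G` if `G - C` is disconnected or is a single vertex.
(The null graph, obtained by deleting all vertices, counts as neither.) -/
def IsVertexCut {V : Type*} (G : SimpleGraph V) (C : Finset V) : Prop :=
  ¬ (G.induce {v | v ∉ C}).Preconnected ∨ Nat.card {v // v ∉ C} = 1

/-- The vertex connectivity `κ(G)`: the minimum cardinality of a vertex-cut. For a complete graph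
on `n ≥ 1` vertices this is `n - 1`; for other graphs it is the minimum number of vertices whose
deletion disconnects the graph. -/
noncomputable def vertexConnectivity {V : Type*} (G : SimpleGraph V) : ℕ :=
  sInf {c | ∃ C : Finset V, G.IsVertexCut C ∧ C.card = c}

/-- `G` is `k`-connected if `κ(G) ≥ k`. -/
def IsKVertexConnected {V : Type*} (G : SimpleGraph V) (k : ℕ) : Prop :=
  k ≤ G.vertexConnectivity

/-- The signless Laplacian matrix `Q(G) = D(G) + A(G)`. -/
def signlessLapMatrix {V : Type*} [Fintype V] [DecidableEq V] (G : SimpleGraph V)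
    [DecidableRel G.Adj] : Matrix V V ℝ :=
  G.degMatrix ℝ + G.adjMatrix ℝ

/-- The `Q`-index `q(G)`: the largest eigenvalue of the signless Laplacian matrix. -/
noncomputable def qIndex {V : Type*} [Fintype V] [DecidableEq V] (G : SimpleGraph V)
    [DecidableRel G.Adj] : ℝ :=
  sSup {μ : ℝ | Module.End.HasEigenvalue (Matrix.toLin' G.signlessLapMatrix) μ}

/-- The number `ν(δ, g, κ)`, where `t = ⌊(g - 1) / 2⌋`. It is integer valued so that no
subtraction is truncated. -/
def nuGirth (δ g κ : ℕ) : ℤ :=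
  if Odd g then
    1 + ((δ : ℤ) - κ) * ∑ i ∈ Finset.range ((g - 1) / 2), ((δ : ℤ) - 1) ^ i
  else if 3 ≤ δ then
    2 + (2 * (δ : ℤ) - 2 - κ) * ∑ i ∈ Finset.range ((g - 1) / 2), ((δ : ℤ) - 1) ^ i
  else
    2 * (((g - 1) / 2 : ℕ) : ℤ) + 1

end SimpleGraph

/-! Suppose that a vertex-cut `C` has fewer than `k ≤ δ` vertices. It leaves two nonempty sides `X`
and `Y` with no edge between them. Three estimates then push `q(G)` strictly below the assumed
threshold.

Sides are large. Below the girth, non-backtracking walks from a vertex, or out of an edge when the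
girth is even, span a tree with disjoint branches. A vertex of `C` spoils at most one branch, and an
unspoiled branch stays on its side; counting gives at least `ν` vertices (`nuGirth_le_card`). For
even girth and `δ = 2` the cut is a single vertex, and a long path replaces the tree.

Edges are few. Every edge lies in `X ∪ C` or in `Y ∪ C`. Passing to these parts does not lower the
girth, so the Moore bound for irregular graphs (`sum_degree_edgesWithin_lt`) bounds the degree sum
of a part with `N` vertices by `N (N/K)^(1/t) + N`. Here `K` is 1 for odd girth and 2 for even
girth, where the two spheres around an edge are disjoint. As `N^(1 + 1/t)` is convex, the total is
largest when one side has exactly `ν` vertices (`sum_degree_lt_of_cut`).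

Few edges force a small `Q`-index. This is the Feng–Yu bound `q ≤ 2m/(n-1) + n - 2`, with `m` the
number of edges (`qIndex_le`). -/

namespace SimpleGraph

/-! ### Non-backtracking walks and spheres below the girth. -/

variable {V : Type*} {G : SimpleGraph V}

/-- Two paths with the same ends whose total length is smaller than the girth coincide. -/
lemma Walk.IsPath.eq_of_length_add_length_lt_egirth {u v : V} {p q : G.Walk u v}
    (hp : p.IsPath) (hq : q.IsPath) (h : ((p.length + q.length : ℕ) : ℕ∞) < G.egirth) :
    p = q := by
  classical
  set s : Set (Sym2 V) := {e | e ∈ p.edges ∨ e ∈ q.edges} with hs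
  have hsG : fromEdgeSet s ≤ G := by
    intro a b hab
    rcases hab.1 with h | h
    · exact p.adj_of_mem_edges h
    · exact q.adj_of_mem_edges h
  have hmem : ∀ {a b : V} (r : G.Walk a b), (∀ e ∈ r.edges, e ∈ s) →
      ∀ e ∈ r.edges, e ∈ (fromEdgeSet s).edgeSet := by
    intro a b r hr e he
    rw [edgeSet_fromEdgeSet]
    exact ⟨hr e he, G.not_isDiag_of_mem_edgeSet (r.edges_subset_edgeSet he)⟩
  have hp' := hmem p fun e he => Or.inl he
  have hq' := hmem q fun e he => Or.inr he
  -- In the graph formed by the edges of both paths, either paths are unique or there is a cycle,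
  -- whose length is at most `p.length + q.length`.
  by_cases hac : (fromEdgeSet s).IsAcyclic
  · have := (hac.subsingleton_path u v).elim ⟨p.transfer _ hp', hp.transfer hp'⟩ ⟨q.transfer _ hq', hq.transfer hq'⟩
    have := congrArg (fun r : (fromEdgeSet s).Path u v => (r : (fromEdgeSet s).Walk u v).support)
      this
    exact Walk.ext_support (by simpa using this)
  · exfalso
    obtain ⟨a, c, hc, hlen⟩ := exists_egirth_eq_length.mpr hac
    have h1 : G.egirth ≤ c.length := by
      have := egirth_le_length (hc.mapLe hsG)
      simpa using this
    have h2 : c.length ≤ p.length + q.length := by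
      rw [← c.length_edges, ← p.length_edges, ← q.length_edges, ← List.length_append,
        ← List.toFinset_card_of_nodup hc.edges_nodup]
      refine le_trans (Finset.card_le_card ?_) (List.toFinset_card_le _)
      intro e he
      have := c.edges_subset_edgeSet (List.mem_toFinset.mp he)
      rw [edgeSet_fromEdgeSet] at this
      simpa [hs] using this.1
    exact absurd (h.trans_le h1) (not_lt.mpr (by exact_mod_cast h2))

/-- A path of length less than `girth - 1` leaving `v` along an edge other than `vu` avoids `u`. -/
lemma Walk.IsPath.notMem_support_of_lt_egirth {u v w x : V} (huv : G.Adj u v) (hvw : G.Adj v w)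
    (hne : w ≠ u) {q : G.Walk w x} (hq : (Walk.cons hvw q).IsPath)
    (h : ((q.length + 2 : ℕ) : ℕ∞) < G.egirth) : u ∉ (Walk.cons hvw q).support := by
  classical
  intro hu
  rw [Walk.support_cons, List.mem_cons] at hu
  rcases hu with hu | hu
  · exact huv.ne hu
  · have hq' := (Walk.cons_isPath_iff hvw q).mp hq
    have hr : (Walk.cons hvw (q.takeUntil u hu)).IsPath := by
      rw [Walk.cons_isPath_iff]
      exact ⟨hq'.1.takeUntil hu, fun hv => hq'.2 (q.support_takeUntil_subset_support hu hv)⟩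
    have he : (Walk.cons huv.symm Walk.nil).IsPath := by
      simp [Walk.cons_isPath_iff, huv.ne']
    -- If `u` were on the walk, its initial piece from `v` to `u` would have to be the edge `vu`,
    -- forcing `w = u`.
    have := hr.eq_of_length_add_length_lt_egirth he (by
      refine lt_of_le_of_lt ?_ h
      have := q.length_takeUntil_le_length hu
      simp only [Walk.length_cons, Walk.length_nil]
      exact_mod_cast by omega)
    have := congrArg (fun r : G.Walk v u => r.snd) this
    simp at this
    exact hne this

variable [Fintype V] [DecidableEq V] [DecidableRel G.Adj]

variable (G) in
/-- The ends of the non-backtracking walks that start with the step from `u` to `v` and continue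
with `j` further steps. -/
def nbSphere : ℕ → V → V → Finset V
  | 0, _, v => {v}
  | j + 1, u, v => ((G.neighborFinset v).erase u).biUnion fun w => nbSphere j v w

lemma mem_nbSphere_succ {j : ℕ} {u v x : V} :
    x ∈ G.nbSphere (j + 1) u v ↔ ∃ w, w ≠ u ∧ G.Adj v w ∧ x ∈ G.nbSphere j v w := by
  simp [nbSphere, and_assoc]

/-- A non-backtracking walk that revisited a vertex would close a cycle no longer than itself. The
induction prepends one edge at a time. -/
lemma exists_isPath_of_mem_nbSphere {j : ℕ} {u v x : V} (huv : G.Adj u v)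
    (h : ((j + 1 : ℕ) : ℕ∞) < G.egirth) (hx : x ∈ G.nbSphere j u v) :
    ∃ q : G.Walk v x, (Walk.cons huv q).IsPath ∧ q.length = j := by
  induction j generalizing u v with
  | zero =>
    obtain rfl : x = v := by simpa [nbSphere] using hx
    exact ⟨Walk.nil, by simp [Walk.cons_isPath_iff, huv.ne], rfl⟩
  | succ j ih =>
    obtain ⟨w, hwu, hvw, hxw⟩ := mem_nbSphere_succ.mp hx
    obtain ⟨q, hq, hlen⟩ := ih hvw (lt_of_le_of_lt (by exact_mod_cast by omega) h) hxw
    refine ⟨Walk.cons hvw q, ?_, by simp [hlen]⟩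
    rw [Walk.cons_isPath_iff]
    exact ⟨hq, hq.notMem_support_of_lt_egirth huv hvw hwu (by rw [hlen]; exact h)⟩

/-- A vertex reached from `u` by two short non-backtracking walks is reached by the same first
step and after the same number of steps. -/
lemma eq_and_eq_of_mem_nbSphere {i j : ℕ} {u v w x : V} (huv : G.Adj u v) (huw : G.Adj u w)
    (h : ((i + j + 2 : ℕ) : ℕ∞) < G.egirth) (hv : x ∈ G.nbSphere i u v)
    (hw : x ∈ G.nbSphere j u w) : v = w ∧ i = j := by
  obtain ⟨p, hp, hpl⟩ := exists_isPath_of_mem_nbSphere huv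
    (lt_of_le_of_lt (by exact_mod_cast by omega) h) hv
  obtain ⟨q, hq, hql⟩ := exists_isPath_of_mem_nbSphere huw
    (lt_of_le_of_lt (by exact_mod_cast by omega) h) hw
  have := hp.eq_of_length_add_length_lt_egirth hq (by
    refine lt_of_le_of_lt ?_ h
    simp only [Walk.length_cons]
    exact_mod_cast by omega)
  have h1 := congrArg (fun r : G.Walk u x => r.snd) this
  have h2 := congrArg (fun r : G.Walk u x => r.length) this
  simp only [Walk.snd_cons, Walk.length_cons] at h1 h2
  exact ⟨h1, by omega⟩

lemma notMem_nbSphere_left {j : ℕ} {u v : V} (huv : G.Adj u v)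
    (h : ((j + 1 : ℕ) : ℕ∞) < G.egirth) : u ∉ G.nbSphere j u v := by
  intro hu
  obtain ⟨q, hq, -⟩ := exists_isPath_of_mem_nbSphere huv h hu
  simpa using Walk.isPath_iff_nil.mp hq

lemma notMem_nbSphere_right {j : ℕ} {u v : V} (huv : G.Adj u v) (hj : j ≠ 0)
    (h : ((j + 1 : ℕ) : ℕ∞) < G.egirth) : v ∉ G.nbSphere j u v := by
  intro hu
  obtain ⟨q, hq, hl⟩ := exists_isPath_of_mem_nbSphere huv h hu
  rw [Walk.cons_isPath_iff] at hq
  exact hj (hl ▸ Walk.length_eq_zero_iff.mpr (Walk.isPath_iff_nil.mp hq.1))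

/-- The two sides of the tree grown from an edge are disjoint. -/
lemma disjoint_nbSphere_swap {i j : ℕ} {u v : V} (huv : G.Adj u v)
    (h : ((i + j + 1 : ℕ) : ℕ∞) < G.egirth) :
    Disjoint (G.nbSphere i u v) (G.nbSphere j v u) := by
  rw [Finset.disjoint_left]
  intro x hx hx'
  cases i with
  | zero =>
    obtain rfl : x = v := by simpa [nbSphere] using hx
    exact notMem_nbSphere_left huv.symm (lt_of_le_of_lt (by exact_mod_cast by omega) h) hx'
  | succ i =>
    obtain ⟨w, hwu, hvw, hxw⟩ := mem_nbSphere_succ.mp hx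
    exact hwu (eq_and_eq_of_mem_nbSphere hvw huv.symm
      (lt_of_le_of_lt (by exact_mod_cast by omega) h) hxw hx').1

/-- The subspheres through different `w` are disjoint: a common point would give two paths from `v`
of total length `2 * (j + 1)`. -/
lemma card_nbSphere_succ {j : ℕ} {u v : V} (h : ((2 * (j + 1) : ℕ) : ℕ∞) < G.egirth) :
    (G.nbSphere (j + 1) u v).card =
      ∑ w ∈ (G.neighborFinset v).erase u, (G.nbSphere j v w).card := by
  rw [nbSphere, Finset.card_biUnion]
  intro w hw w' hw' hne
  refine Finset.disjoint_left.mpr fun x hx hx' => ?_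
  exact hne (eq_and_eq_of_mem_nbSphere
    (by simpa using Finset.mem_of_mem_erase hw) (by simpa using Finset.mem_of_mem_erase hw')
    (lt_of_le_of_lt (by exact_mod_cast by omega) h) hx hx').1

lemma card_erase_neighborFinset {u v : V} (huv : G.Adj u v) :
    ((G.neighborFinset v).erase u).card = G.degree v - 1 := by
  rw [Finset.card_erase_of_mem (by simpa using huv.symm), card_neighborFinset_eq_degree]

lemma pow_le_card_nbSphere {δ j : ℕ} (hδ : ∀ v, δ ≤ G.degree v) {u v : V} (huv : G.Adj u v)
    (h : ((2 * j : ℕ) : ℕ∞) < G.egirth) : (δ - 1) ^ j ≤ (G.nbSphere j u v).card := by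
  induction j generalizing u v with
  | zero => simp [nbSphere]
  | succ j ih =>
    rw [card_nbSphere_succ h]
    calc (δ - 1) ^ (j + 1) ≤ ((G.neighborFinset v).erase u).card * (δ - 1) ^ j := by
          rw [card_erase_neighborFinset huv, pow_succ']
          exact Nat.mul_le_mul_right _ (Nat.sub_le_sub_right (hδ v) 1)
      _ ≤ _ := by
          rw [← smul_eq_mul]
          refine Finset.card_nsmul_le_sum _ _ _ fun w hw => ih ?_
            (lt_of_le_of_lt (by exact_mod_cast by omega) h)
          simpa using (Finset.mem_erase.mp hw).2

end SimpleGraph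

/-! ### Tree counting: lower bounds for the sides of a cut. -/

namespace SimpleGraph

/-- If at most `#C` of the disjoint sets `B i` meet `C` and the others lie in `X`, then `X` is
large. -/
lemma card_add_card_mul_le {V ι : Type*} [DecidableEq V] [DecidableEq ι] {I : Finset ι}
    {B : ι → Finset V} {β : ℕ} {K X C : Finset V} (hβ : ∀ i ∈ I, β ≤ (B i).card)
    (hB : (I : Set ι).PairwiseDisjoint B) (hK : ∀ i ∈ I, Disjoint K (B i)) (hKX : K ⊆ X)
    (hX : ∀ i ∈ I, Disjoint (B i) C → B i ⊆ X) :
    K.card + I.card * β ≤ X.card + C.card * β := by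
  set J := I.filter fun i => Disjoint (B i) C with hJ
  set J' := I.filter fun i => ¬ Disjoint (B i) C with hJ'
  have hcard : J.card + J'.card = I.card := Finset.card_filter_add_card_filter_not _
  -- The sets meeting `C` have disjoint nonempty traces on `C`.
  have hbad : J'.card ≤ C.card := by
    have h1 : (J'.biUnion fun i => B i ∩ C).card = ∑ i ∈ J', (B i ∩ C).card := by
      refine Finset.card_biUnion fun i hi j hj hij => ?_
      exact (hB (Finset.mem_filter.mp hi).1 (Finset.mem_filter.mp hj).1 hij).mono
        Finset.inter_subset_left Finset.inter_subset_left
    have h2 : J'.card ≤ ∑ i ∈ J', (B i ∩ C).card := by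
      rw [Finset.card_eq_sum_ones]
      refine Finset.sum_le_sum fun i hi => ?_
      rw [Nat.one_le_iff_ne_zero, Ne, Finset.card_eq_zero, ← Finset.disjoint_iff_inter_eq_empty]
      exact (Finset.mem_filter.mp hi).2
    refine h2.trans (h1 ▸ Finset.card_le_card ?_)
    exact Finset.biUnion_subset.mpr fun i _ => Finset.inter_subset_right
  have hgood : K.card + J.card * β ≤ X.card := by
    have h1 : (J.biUnion B).card = ∑ i ∈ J, (B i).card :=
      Finset.card_biUnion fun i hi j hj hij =>
        hB (Finset.mem_filter.mp hi).1 (Finset.mem_filter.mp hj).1 hij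
    have h2 : J.card * β ≤ (J.biUnion B).card := by
      rw [h1, ← smul_eq_mul]
      exact Finset.card_nsmul_le_sum _ _ _ fun i hi => hβ i (Finset.mem_filter.mp hi).1
    have h3 : Disjoint K (J.biUnion B) := by
      rw [Finset.disjoint_biUnion_right]
      exact fun i hi => hK i (Finset.mem_filter.mp hi).1
    have h4 : K ∪ J.biUnion B ⊆ X := by
      refine Finset.union_subset hKX (Finset.biUnion_subset.mpr fun i hi => ?_)
      exact hX i (Finset.mem_filter.mp hi).1 (Finset.mem_filter.mp hi).2
    have := Finset.card_le_card h4
    rw [Finset.card_union_of_disjoint h3] at this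
    omega
  have := Nat.mul_le_mul_right β hbad
  rw [← hcard, add_mul]
  omega

variable {V : Type*} [Fintype V] [DecidableEq V] {G : SimpleGraph V} [DecidableRel G.Adj]

variable (G) in
/-- The branch at `u` through the neighbour `v`: the vertices other than `u` that are reached by
non-backtracking walks of length at most `t` whose first step is from `u` to `v`. -/
def nbBranch (t : ℕ) (u v : V) : Finset V :=
  (Finset.range t).biUnion fun j => G.nbSphere j u v

lemma mem_nbBranch {t : ℕ} {u v x : V} :
    x ∈ G.nbBranch t u v ↔ ∃ j < t, x ∈ G.nbSphere j u v := by
  simp [nbBranch]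

lemma sum_pow_le_card_nbBranch {δ t : ℕ} (hδ : ∀ v, δ ≤ G.degree v) {u v : V} (huv : G.Adj u v)
    (h : ((2 * t : ℕ) : ℕ∞) < G.egirth) :
    ∑ i ∈ Finset.range t, (δ - 1) ^ i ≤ (G.nbBranch t u v).card := by
  rw [nbBranch, Finset.card_biUnion]
  · refine Finset.sum_le_sum fun j hj => pow_le_card_nbSphere hδ huv ?_
    have := Finset.mem_range.mp hj
    exact lt_of_le_of_lt (by exact_mod_cast by omega) h
  · intro i hi j hj hij
    have hi := Finset.mem_range.mp hi
    have hj := Finset.mem_range.mp hj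
    refine Finset.disjoint_left.mpr fun x hx hx' => ?_
    exact hij (eq_and_eq_of_mem_nbSphere huv huv
      (lt_of_le_of_lt (by exact_mod_cast by omega) h) hx hx').2

lemma disjoint_nbBranch {t : ℕ} {u v w : V} (huv : G.Adj u v) (huw : G.Adj u w) (hne : v ≠ w)
    (h : ((2 * t : ℕ) : ℕ∞) < G.egirth) :
    Disjoint (G.nbBranch t u v) (G.nbBranch t u w) := by
  rw [Finset.disjoint_left]
  intro x hx hx'
  obtain ⟨i, hi, hx⟩ := mem_nbBranch.mp hx
  obtain ⟨j, hj, hx'⟩ := mem_nbBranch.mp hx'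
  exact hne (eq_and_eq_of_mem_nbSphere huv huw
    (lt_of_le_of_lt (by exact_mod_cast by omega) h) hx hx').1

/-- Prepending the edge `uu'` puts the branches into spheres on opposite sides of that edge. The
cycle excluded may have length `2 * t + 1`, hence the stronger girth hypothesis. -/
lemma disjoint_nbBranch_of_adj {t : ℕ} {u u' v w : V} (huu : G.Adj u u') (huv : G.Adj u v)
    (huw : G.Adj u' w) (hv : v ≠ u') (hw : w ≠ u) (h : ((2 * t + 1 : ℕ) : ℕ∞) < G.egirth) :
    Disjoint (G.nbBranch t u v) (G.nbBranch t u' w) := by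
  rw [Finset.disjoint_left]
  intro x hx hx'
  obtain ⟨i, hi, hx⟩ := mem_nbBranch.mp hx
  obtain ⟨j, hj, hx'⟩ := mem_nbBranch.mp hx'
  have h1 : x ∈ G.nbSphere (i + 1) u' u := mem_nbSphere_succ.mpr ⟨v, hv, huv, hx⟩
  have h2 : x ∈ G.nbSphere (j + 1) u u' := mem_nbSphere_succ.mpr ⟨w, hw, huw, hx'⟩
  exact Finset.disjoint_left.mp (disjoint_nbSphere_swap huu
    (lt_of_le_of_lt (by exact_mod_cast by omega) h)) h2 h1

lemma notMem_nbBranch_left {t : ℕ} {u v : V} (huv : G.Adj u v)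
    (h : ((2 * t : ℕ) : ℕ∞) < G.egirth) : u ∉ G.nbBranch t u v := by
  intro hu
  obtain ⟨j, hj, hu⟩ := mem_nbBranch.mp hu
  exact notMem_nbSphere_left huv (lt_of_le_of_lt (by exact_mod_cast by omega) h) hu

lemma notMem_nbBranch_of_adj {t : ℕ} {u u' v : V} (huu : G.Adj u u') (huv : G.Adj u v)
    (hv : v ≠ u') (h : ((2 * t : ℕ) : ℕ∞) < G.egirth) : u' ∉ G.nbBranch t u v := by
  intro hu
  obtain ⟨j, hj, hu⟩ := mem_nbBranch.mp hu
  exact notMem_nbSphere_left huu.symm (j := j + 1)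
    (lt_of_le_of_lt (by exact_mod_cast by omega) h) (mem_nbSphere_succ.mpr ⟨v, hv, huv, hu⟩)

/-- A walk from `X` can leave `X` only through `C`, so all shallower spheres must avoid `C` too. -/
lemma nbSphere_subset_of_disjoint {X C : Finset V}
    (hX : ∀ u ∈ X, ∀ v, G.Adj u v → v ∉ C → v ∈ X) {i : ℕ} {u v : V} (hu : u ∈ X)
    (huv : G.Adj u v) (hC : ∀ j ≤ i, Disjoint (G.nbSphere j u v) C) : G.nbSphere i u v ⊆ X := by
  induction i generalizing u v with
  | zero =>
    have := hC 0 le_rfl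
    simp only [nbSphere, Finset.disjoint_singleton_left, Finset.singleton_subset_iff] at this ⊢
    exact hX u hu v huv this
  | succ i ih =>
    have hv : v ∈ X := by
      have := hC 0 (Nat.zero_le _)
      simp only [nbSphere, Finset.disjoint_singleton_left] at this
      exact hX u hu v huv this
    intro x hx
    obtain ⟨w, hwu, hvw, hxw⟩ := mem_nbSphere_succ.mp hx
    refine ih hv hvw (fun j hj => ?_) hxw
    refine (hC (j + 1) (by omega)).mono_left fun y hy => ?_
    exact mem_nbSphere_succ.mpr ⟨w, hwu, hvw, hy⟩

lemma nbBranch_subset_of_disjoint {X C : Finset V}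
    (hX : ∀ u ∈ X, ∀ v, G.Adj u v → v ∉ C → v ∈ X) {t : ℕ} {u v : V} (hu : u ∈ X)
    (huv : G.Adj u v) (hC : Disjoint (G.nbBranch t u v) C) : G.nbBranch t u v ⊆ X := by
  rw [nbBranch, Finset.disjoint_biUnion_left] at hC
  refine Finset.biUnion_subset.mpr fun i hi => nbSphere_subset_of_disjoint hX hu huv fun j hj => ?_
  exact hC j (by simp at hi ⊢; omega)

/-- A nonempty union of components of `G - C` contains the branches at any of its vertices that
avoid `C`. -/
lemma one_add_mul_sum_le_card_of_cut {X C : Finset V}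
    (hX : ∀ u ∈ X, ∀ v, G.Adj u v → v ∉ C → v ∈ X) (hne : X.Nonempty) {δ t : ℕ}
    (hδ : ∀ v, δ ≤ G.degree v) (h : ((2 * t : ℕ) : ℕ∞) < G.egirth) :
    1 + δ * ∑ i ∈ Finset.range t, (δ - 1) ^ i ≤
      X.card + C.card * ∑ i ∈ Finset.range t, (δ - 1) ^ i := by
  obtain ⟨x, hx⟩ := hne
  have := card_add_card_mul_le (I := G.neighborFinset x) (B := G.nbBranch t x)
    (β := ∑ i ∈ Finset.range t, (δ - 1) ^ i) (K := {x}) (X := X) (C := C)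
    (fun v hv => sum_pow_le_card_nbBranch hδ (by simpa using hv) h)
    (fun v hv w hw hne => disjoint_nbBranch (by simpa using hv) (by simpa using hw) hne h)
    (fun v hv => by
      rw [Finset.disjoint_singleton_left]
      exact notMem_nbBranch_left (by simpa using hv) h)
    (by simpa using hx)
    (fun v hv hC => nbBranch_subset_of_disjoint hX hx (by simpa using hv) hC)
  rw [Finset.card_singleton, card_neighborFinset_eq_degree] at this
  exact le_trans (Nat.add_le_add_left (Nat.mul_le_mul_right _ (hδ x)) 1) this

/-- A union of components of `G - C` that contains an edge contains the branches at this edge that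
avoid `C`. -/
lemma two_add_mul_sum_le_card_of_cut {X C : Finset V}
    (hX : ∀ u ∈ X, ∀ v, G.Adj u v → v ∉ C → v ∈ X) {x y : V} (hx : x ∈ X) (hy : y ∈ X)
    (hxy : G.Adj x y) {δ t : ℕ} (hδ : ∀ v, δ ≤ G.degree v)
    (h : ((2 * t + 1 : ℕ) : ℕ∞) < G.egirth) :
    2 + 2 * (δ - 1) * ∑ i ∈ Finset.range t, (δ - 1) ^ i ≤
      X.card + C.card * ∑ i ∈ Finset.range t, (δ - 1) ^ i := by
  have h' : ((2 * t : ℕ) : ℕ∞) < G.egirth := lt_of_le_of_lt (by exact_mod_cast by omega) h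
  -- The darts leaving the edge `xy` at either end index its branches.
  set I : Finset (V × V) := ({x} ×ˢ (G.neighborFinset x).erase y) ∪
    ({y} ×ˢ (G.neighborFinset y).erase x) with hI
  have hmem : ∀ i ∈ I, (i.1 = x ∧ G.Adj x i.2 ∧ i.2 ≠ y) ∨ (i.1 = y ∧ G.Adj y i.2 ∧ i.2 ≠ x) := by
    rintro ⟨a, b⟩ hi
    simp only [hI, Finset.mem_union, Finset.mem_product, Finset.mem_singleton, Finset.mem_erase,
      mem_neighborFinset] at hi
    tauto
  have hIcard : 2 * (δ - 1) ≤ I.card := by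
    rw [hI, Finset.card_union_of_disjoint, Finset.card_product, Finset.card_product,
      Finset.card_singleton, Finset.card_singleton, card_erase_neighborFinset hxy,
      card_erase_neighborFinset hxy.symm]
    · have := hδ x
      have := hδ y
      omega
    · rw [Finset.disjoint_left]
      rintro ⟨a, b⟩ h1 h2
      simp only [Finset.mem_product, Finset.mem_singleton] at h1 h2
      exact hxy.ne (h1.1.symm.trans h2.1)
  have hadj : ∀ i ∈ I, i.1 ∈ X ∧ G.Adj i.1 i.2 := by
    intro i hi
    rcases hmem i hi with ⟨h1, h2, -⟩ | ⟨h1, h2, -⟩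
    · exact ⟨h1 ▸ hx, h1.symm ▸ h2⟩
    · exact ⟨h1 ▸ hy, h1.symm ▸ h2⟩
  have := card_add_card_mul_le (I := I) (B := fun i => G.nbBranch t i.1 i.2)
    (β := ∑ i ∈ Finset.range t, (δ - 1) ^ i) (K := {x, y}) (X := X) (C := C)
    (fun i hi => sum_pow_le_card_nbBranch hδ (hadj i hi).2 h')
    (by
      rintro ⟨a, b⟩ hi ⟨a', b'⟩ hj hne
      have hne' : ¬ (a = a' ∧ b = b') := by simpa using hne
      rcases hmem _ hi with ⟨h1, h2, h3⟩ | ⟨h1, h2, h3⟩ <;>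
        rcases hmem _ hj with ⟨h1', h2', h3'⟩ | ⟨h1', h2', h3'⟩ <;>
        simp only at h1 h2 h3 h1' h2' h3' <;> subst h1 <;> subst h1'
      · exact disjoint_nbBranch h2 h2' (by tauto) h'
      · exact disjoint_nbBranch_of_adj hxy h2 h2' h3 h3' h
      · exact disjoint_nbBranch_of_adj hxy.symm h2 h2' h3 h3' h
      · exact disjoint_nbBranch h2 h2' (by tauto) h')
    (by
      rintro ⟨a, b⟩ hi
      rw [Finset.disjoint_insert_left, Finset.disjoint_singleton_left]
      rcases hmem _ hi with ⟨h1, h2, h3⟩ | ⟨h1, h2, h3⟩ <;> simp only at h1 h2 h3 <;> subst h1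
      · exact ⟨notMem_nbBranch_left h2 h', notMem_nbBranch_of_adj hxy h2 h3 h'⟩
      · exact ⟨notMem_nbBranch_of_adj hxy.symm h2 h3 h', notMem_nbBranch_left h2 h'⟩)
    (by
      intro z hz
      rcases Finset.mem_insert.mp hz with rfl | hz
      · exact hx
      · rwa [Finset.mem_singleton.mp hz])
    (fun i hi hC => nbBranch_subset_of_disjoint hX (hadj i hi).1 (hadj i hi).2 hC)
  rw [Finset.card_pair hxy.ne] at this
  exact le_trans (Nat.add_le_add_left (Nat.mul_le_mul_right _ hIcard) 2) this

/-- Starting at a cut vertex `z`, a path in a component of `G - z` can be prolonged until it has as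
many vertices as a shortest cycle. -/
lemma le_card_add_one_of_cut_vertex {X : Finset V} {z : V} (hzX : z ∉ X)
    (hX : ∀ u ∈ X, ∀ v, G.Adj u v → v ≠ z → v ∈ X) {y : V} (hy : y ∈ X) (hyz : G.Adj y z)
    (hδ : ∀ v, 2 ≤ G.degree v) {g : ℕ} (hg2 : 2 ≤ g) (hg : (g : ℕ∞) ≤ G.egirth) :
    g ≤ X.card + 1 := by
  -- The path grows at its start `x`: a second neighbour of `x` is off the path by the girth, so it
  -- is not `z` and lies in `X`.
  have key : ∀ j, j + 1 < g → ∃ x ∈ X, ∃ p : G.Walk x z, p.IsPath ∧ p.length = j + 1 ∧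
      ∀ w ∈ p.support, w ∈ insert z X := by
    intro j
    induction j with
    | zero =>
      intro _
      refine ⟨y, hy, Walk.cons hyz Walk.nil, by simp [Walk.cons_isPath_iff, hyz.ne], rfl, ?_⟩
      simp [hy]
    | succ j ih =>
      intro hj
      obtain ⟨x, hx, p, hp, hpl, hps⟩ := ih (by omega)
      cases p with
      | nil => simp at hpl
      | @cons _ w _ hxw q =>
        obtain ⟨u, hu, huw⟩ : ∃ u ∈ G.neighborFinset x, u ≠ w := by
          apply Finset.exists_mem_ne
          rw [card_neighborFinset_eq_degree]
          exact hδ x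
        have hxu : G.Adj x u := by simpa using hu
        have hus : u ∉ (Walk.cons hxw q).support := by
          refine hp.notMem_support_of_lt_egirth hxu.symm hxw huw.symm (lt_of_lt_of_le ?_ hg)
          simp only [Walk.length_cons] at hpl
          exact_mod_cast by omega
        have huz : u ≠ z := by
          rintro rfl
          exact hus (Walk.end_mem_support _)
        refine ⟨u, hX x hx u hxu huz, Walk.cons hxu.symm (Walk.cons hxw q), ?_, ?_, ?_⟩
        · rw [Walk.cons_isPath_iff]
          exact ⟨hp, hus⟩
        · simpa using hpl
        · intro v hv
          rw [Walk.support_cons, List.mem_cons] at hv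
          rcases hv with rfl | hv
          · exact Finset.mem_insert_of_mem (hX x hx _ hxu huz)
          · exact hps v hv
  obtain ⟨x, -, p, hp, hpl, hps⟩ := key (g - 2) (by omega)
  have : p.support.toFinset ⊆ insert z X := fun w hw => hps w (List.mem_toFinset.mp hw)
  have := Finset.card_le_card this
  rw [List.toFinset_card_of_nodup hp.support_nodup, Walk.length_support,
    Finset.card_insert_of_notMem hzX] at this
  omega

end SimpleGraph

/-! ### The Moore bound for irregular graphs. -/

namespace SimpleGraph

/-- Jensen's inequality for the logarithm, with equal weights. -/
lemma log_card_add_sum_log_div_card_le {ι : Type*} {T : Finset ι} (hT : T.Nonempty) {a : ι → ℝ}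
    (ha : ∀ i ∈ T, 0 < a i) :
    Real.log T.card + (∑ i ∈ T, Real.log (a i)) / T.card ≤ Real.log (∑ i ∈ T, a i) := by
  have hc : (0 : ℝ) < T.card := by exact_mod_cast hT.card_pos
  have := strictConcaveOn_log_Ioi.concaveOn.le_map_sum (t := T) (w := fun _ => (T.card : ℝ)⁻¹)
    (p := a) (fun _ _ => by positivity) (by simp [hc.ne']) ha
  simp only [smul_eq_mul, ← Finset.mul_sum] at this
  have hsum : 0 < ∑ i ∈ T, a i := Finset.sum_pos ha hT
  rw [Real.log_mul (by positivity) hsum.ne', Real.log_inv] at this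
  rw [div_eq_inv_mul]
  linarith

/-- The second derivative is `(x - 2) / (x - 1) ^ 2`; its sign is why minimum degree 2 is needed
later. -/
lemma convexOn_mul_log_sub_one :
    ConvexOn ℝ (Set.Ici (2 : ℝ)) fun x : ℝ => x * Real.log (x - 1) := by
  have hd : ∀ x : ℝ, 1 < x →
      HasDerivAt (fun x : ℝ => x * Real.log (x - 1)) (Real.log (x - 1) + x / (x - 1)) x := by
    intro x hx
    have h1 : HasDerivAt (fun x : ℝ => Real.log (x - 1)) (1 / (x - 1)) x :=
      ((hasDerivAt_id x).sub_const 1).log (by simpa using (sub_pos.mpr hx).ne')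
    exact ((hasDerivAt_id' x).mul h1).congr_deriv (by ring)
  have hd2 : ∀ x : ℝ, 1 < x → HasDerivAt (fun x : ℝ => Real.log (x - 1) + x / (x - 1))
      ((x - 2) / (x - 1) ^ 2) x := by
    intro x hx
    have hx' : x - 1 ≠ 0 := (sub_pos.mpr hx).ne'
    have h0 : HasDerivAt (fun x : ℝ => x - 1) 1 x := (hasDerivAt_id x).sub_const 1
    refine ((h0.log hx').add ((hasDerivAt_id' x).div h0 hx')).congr_deriv ?_
    field_simp
    ring
  refine MonotoneOn.convexOn_of_deriv (convex_Ici 2) ?_ ?_ ?_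
  · intro x hx
    exact (hd x (by have : (2 : ℝ) ≤ x := hx; linarith)).continuousAt.continuousWithinAt
  · intro x hx
    rw [interior_Ici] at hx
    exact (hd x (by have : (2 : ℝ) < x := hx; linarith)).differentiableAt.differentiableWithinAt
  · rw [interior_Ici]
    have hE : Set.EqOn (deriv fun x : ℝ => x * Real.log (x - 1))
        (fun x : ℝ => Real.log (x - 1) + x / (x - 1)) (Set.Ioi 2) := by
      intro x hx
      exact (hd x (by have : (2 : ℝ) < x := hx; linarith)).deriv
    refine MonotoneOn.congr ?_ hE.symm
    refine monotoneOn_of_deriv_nonneg (convex_Ioi 2) ?_ ?_ ?_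
    · intro x hx
      exact (hd2 x (by have : (2 : ℝ) < x := hx; linarith)).continuousAt.continuousWithinAt
    · intro x hx
      rw [interior_Ioi] at hx
      exact (hd2 x (by have : (2 : ℝ) < x := hx; linarith)).differentiableAt.differentiableWithinAt
    · intro x hx
      rw [interior_Ioi] at hx
      have hx : (2 : ℝ) < x := hx
      rw [(hd2 x (by linarith)).deriv]
      have : 0 ≤ x - 2 := by linarith
      positivity

lemma sum_mul_log_sub_one_ge {ι : Type*} {s : Finset ι} (hs : s.Nonempty) {d : ι → ℝ}
    (hd : ∀ i ∈ s, 2 ≤ d i) :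
    (∑ i ∈ s, d i) * Real.log ((∑ i ∈ s, d i) / s.card - 1) ≤
      ∑ i ∈ s, d i * Real.log (d i - 1) := by
  have hc : (0 : ℝ) < s.card := by exact_mod_cast hs.card_pos
  have := convexOn_mul_log_sub_one.map_sum_le (t := s) (w := fun _ => (s.card : ℝ)⁻¹)
    (p := d) (fun _ _ => by positivity) (by simp [hc.ne']) hd
  simp only [smul_eq_mul, ← Finset.mul_sum] at this
  rw [← div_eq_inv_mul, ← div_eq_inv_mul, div_mul_eq_mul_div, div_le_div_iff_of_pos_right hc]
    at this
  exact this

/-- The spanning subgraph of `G` formed by the edges with both ends in `s`. -/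
def edgesWithin {V : Type*} (G : SimpleGraph V) (s : Finset V) : SimpleGraph V where
  Adj u v := G.Adj u v ∧ u ∈ s ∧ v ∈ s
  symm := ⟨fun _ _ h => ⟨h.1.symm, h.2.2, h.2.1⟩⟩
  loopless := ⟨fun _ h => h.1.ne rfl⟩

instance {V : Type*} [DecidableEq V] (G : SimpleGraph V) [DecidableRel G.Adj]
    (s : Finset V) : DecidableRel (G.edgesWithin s).Adj :=
  fun u v => inferInstanceAs (Decidable (G.Adj u v ∧ u ∈ s ∧ v ∈ s))

lemma edgesWithin_adj {V : Type*} {G : SimpleGraph V} {s : Finset V} {u v : V} :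
    (G.edgesWithin s).Adj u v ↔ G.Adj u v ∧ u ∈ s ∧ v ∈ s := Iff.rfl

lemma egirth_le_egirth_edgesWithin {V : Type*} {G : SimpleGraph V} (s : Finset V) :
    G.egirth ≤ (G.edgesWithin s).egirth :=
  egirth_anti fun _ _ h => h.1

lemma sum_sum_neighborFinset_comm {V : Type*} [Fintype V] (G : SimpleGraph V)
    [DecidableRel G.Adj] (F : V → V → ℝ) :
    ∑ u, ∑ v ∈ G.neighborFinset u, F u v = ∑ v, ∑ u ∈ G.neighborFinset v, F u v := by
  refine Finset.sum_comm' fun u v => ?_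
  simp [G.adj_comm]

variable {V : Type*} [Fintype V] [DecidableEq V] {G : SimpleGraph V} [DecidableRel G.Adj]

lemma nbSphere_nonempty (hG : ∀ u v, G.Adj u v → 2 ≤ G.degree v) (j : ℕ) {u v : V}
    (huv : G.Adj u v) : (G.nbSphere j u v).Nonempty := by
  induction j generalizing u v with
  | zero => simp [nbSphere]
  | succ j ih =>
    obtain ⟨w, hw, hwu⟩ : ∃ w ∈ G.neighborFinset v, w ≠ u := by
      apply Finset.exists_mem_ne
      rw [card_neighborFinset_eq_degree]
      exact hG u v huv
    have hvw : G.Adj v w := by simpa using hw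
    obtain ⟨x, hx⟩ := ih hvw
    exact ⟨x, mem_nbSphere_succ.mpr ⟨w, hwu, hvw, hx⟩⟩

/-- Averaging over the steps that do not backtrack preserves the uniform measure on darts. -/
lemma sum_sum_erase_div (hG : ∀ u v, G.Adj u v → 2 ≤ G.degree v) (F : V → V → ℝ) :
    ∑ u, ∑ v ∈ G.neighborFinset u,
        (∑ w ∈ (G.neighborFinset v).erase u, F v w) / ((G.degree v : ℝ) - 1) =
      ∑ v, ∑ w ∈ G.neighborFinset v, F v w := by
  rw [G.sum_sum_neighborFinset_comm]
  refine Finset.sum_congr rfl fun v _ => ?_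
  rcases (G.neighborFinset v).eq_empty_or_nonempty with h0 | ⟨u, hu⟩
  · simp [h0]
  · have hd : (2 : ℝ) ≤ G.degree v := by
      exact_mod_cast hG u v (by simpa using (G.mem_neighborFinset v u).mp hu |>.symm)
    -- Summed over `u`, each `F v w` is counted `G.degree v - 1` times, which cancels the
    -- denominator.
    have h1 : ∀ u ∈ G.neighborFinset v, ∑ w ∈ (G.neighborFinset v).erase u, F v w =
        ∑ w ∈ G.neighborFinset v, F v w - F v u := fun u hu => by
      rw [← Finset.sum_erase_add _ _ hu]; ring
    rw [← Finset.sum_div, Finset.sum_congr rfl h1, Finset.sum_sub_distrib, Finset.sum_const,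
      card_neighborFinset_eq_degree, nsmul_eq_mul, div_eq_iff (by linarith)]
    ring

/-- Jensen on the `d(v) - 1` continuations of a dart gives `log (d(v) - 1)` plus the mean logarithm
of the next spheres. Summed over all darts, the means reproduce the sum for `j`, so each step gains
the same amount. -/
lemma mul_sum_degree_mul_log_le (hG : ∀ u v, G.Adj u v → 2 ≤ G.degree v) {j : ℕ}
    (h : ((2 * j : ℕ) : ℕ∞) < G.egirth) :
    j * ∑ v, (G.degree v : ℝ) * Real.log ((G.degree v : ℝ) - 1) ≤
      ∑ u, ∑ v ∈ G.neighborFinset u, Real.log (G.nbSphere j u v).card := by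
  induction j with
  | zero => simp [nbSphere]
  | succ j ih =>
    have ih := ih (lt_of_le_of_lt (by exact_mod_cast by omega) h)
    have hstep : ∀ u, ∀ v ∈ G.neighborFinset u, Real.log ((G.degree v : ℝ) - 1) +
        (∑ w ∈ (G.neighborFinset v).erase u, Real.log (G.nbSphere j v w).card) /
          ((G.degree v : ℝ) - 1) ≤ Real.log (G.nbSphere (j + 1) u v).card := by
      intro u v hv
      have huv : G.Adj u v := by simpa using hv
      have hd := hG u v huv
      have hcard : (((G.neighborFinset v).erase u).card : ℝ) = (G.degree v : ℝ) - 1 := by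
        rw [card_erase_neighborFinset huv, Nat.cast_sub (by omega), Nat.cast_one]
      have := log_card_add_sum_log_div_card_le (T := (G.neighborFinset v).erase u)
        (a := fun w => ((G.nbSphere j v w).card : ℝ))
        (Finset.card_pos.mp (by rw [card_erase_neighborFinset huv]; omega))
        (fun w hw => by
          have hvw : G.Adj v w := by simpa using Finset.mem_of_mem_erase hw
          exact_mod_cast (nbSphere_nonempty hG j hvw).card_pos)
      rw [hcard] at this
      rw [card_nbSphere_succ h, Nat.cast_sum]
      exact this
    have hsum := Finset.sum_le_sum fun u (_ : u ∈ Finset.univ) => Finset.sum_le_sum (hstep u)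
    simp only [Finset.sum_add_distrib] at hsum
    rw [sum_sum_erase_div hG fun v w => Real.log (G.nbSphere j v w).card,
      G.sum_sum_neighborFinset_comm] at hsum
    simp only [Finset.sum_const, card_neighborFinset_eq_degree, nsmul_eq_mul] at hsum
    push_cast
    linarith

/-- The Moore bound for irregular graphs, in terms of a bound `M` for the geometric mean of the
sizes of the two spheres around an edge. -/
lemma averageDegree_sub_one_pow_le {s : Finset V} (hs : s.Nonempty)
    (hGs : ∀ u v, G.Adj u v → u ∈ s) (hdeg : ∀ v ∈ s, 2 ≤ G.degree v) {t : ℕ}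
    (h : ((2 * t : ℕ) : ℕ∞) < G.egirth) {M : ℝ} (hM0 : 0 < M)
    (hM : ∀ u v, G.Adj u v →
      ((G.nbSphere t u v).card : ℝ) * (G.nbSphere t v u).card ≤ M ^ 2) :
    ((∑ v, (G.degree v : ℝ)) / s.card - 1) ^ t ≤ M := by
  have hG : ∀ u v, G.Adj u v → 2 ≤ G.degree v := fun u v huv => hdeg v (hGs v u huv.symm)
  have hout : ∀ v ∉ s, G.degree v = 0 := by
    intro v hv
    rw [← card_neighborFinset_eq_degree, Finset.card_eq_zero, Finset.eq_empty_iff_forall_notMem]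
    intro w hw
    exact hv (hGs v w (by simpa using hw))
  set D : ℝ := ∑ v, (G.degree v : ℝ) with hD
  have hDs : D = ∑ v ∈ s, (G.degree v : ℝ) :=
    (Finset.sum_subset (Finset.subset_univ s) fun v _ hv => by simp [hout v hv]).symm
  have hc : (0 : ℝ) < s.card := by exact_mod_cast hs.card_pos
  have hD2 : 2 * s.card ≤ D := by
    rw [hDs, mul_comm, ← nsmul_eq_mul]
    exact Finset.card_nsmul_le_sum _ _ _ fun v hv => by exact_mod_cast hdeg v hv
  have hDpos : 0 < D := by linarith
  have h1 := mul_sum_degree_mul_log_le hG h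
  have h2 : D * Real.log (D / s.card - 1) ≤
      ∑ v, (G.degree v : ℝ) * Real.log ((G.degree v : ℝ) - 1) := by
    rw [← Finset.sum_subset (Finset.subset_univ s) fun v _ hv => by simp [hout v hv], hDs]
    exact sum_mul_log_sub_one_ge hs fun v hv => by exact_mod_cast hdeg v hv
  -- Each dart is paired with its reverse, so only the product of the two sphere sizes matters.
  have h3 : 2 * ∑ u, ∑ v ∈ G.neighborFinset u, Real.log (G.nbSphere t u v).card ≤
      D * (2 * Real.log M) := by
    have hswap := G.sum_sum_neighborFinset_comm fun u v => Real.log (G.nbSphere t u v).card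
    rw [two_mul]
    nth_rewrite 2 [hswap]
    rw [← Finset.sum_add_distrib, hD, Finset.sum_mul]
    refine Finset.sum_le_sum fun u _ => ?_
    rw [← Finset.sum_add_distrib, ← card_neighborFinset_eq_degree, ← nsmul_eq_mul]
    refine Finset.sum_le_card_nsmul _ _ _ fun v hv => ?_
    have huv : G.Adj u v := by simpa using hv
    have p1 : (0 : ℝ) < (G.nbSphere t u v).card := by
      exact_mod_cast (nbSphere_nonempty hG t huv).card_pos
    have p2 : (0 : ℝ) < (G.nbSphere t v u).card := by
      exact_mod_cast (nbSphere_nonempty hG t huv.symm).card_pos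
    rw [← Real.log_mul p1.ne' p2.ne']
    calc _ ≤ Real.log (M ^ 2) := Real.log_le_log (by positivity) (hM u v huv)
      _ = _ := by rw [Real.log_pow]; norm_num
  have hpos : 0 < D / s.card - 1 := by
    rw [sub_pos, lt_div_iff₀ hc]; linarith
  have h4 : D * (t * Real.log (D / s.card - 1)) ≤ D * Real.log M := by
    have := mul_le_mul_of_nonneg_left h2 (Nat.cast_nonneg (α := ℝ) t)
    nlinarith
  have h5 := le_of_mul_le_mul_left h4 hDpos
  rw [← Real.log_pow] at h5
  exact (Real.log_le_log_iff (by positivity) hM0).mp h5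

/-- Deleting a vertex of degree at most one loses at most one edge. -/
lemma sum_degree_edgesWithin_le_erase {s : Finset V} {v : V}
    (hv : (G.edgesWithin s).degree v ≤ 1) :
    ∑ u, (G.edgesWithin s).degree u ≤ ∑ u, (G.edgesWithin (s.erase v)).degree u + 2 := by
  have hpt : ∀ u, (G.edgesWithin s).degree u ≤ (G.edgesWithin (s.erase v)).degree u +
      ((if u ∈ (G.edgesWithin s).neighborFinset v then 1 else 0) + if u = v then 1 else 0) := by
    intro u
    by_cases huv : u = v
    · subst huv
      simpa using le_trans hv (by simp)
    · simp only [huv, if_false, add_zero]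
      simp only [← card_neighborFinset_eq_degree]
      have hsub : ((G.edgesWithin s).neighborFinset u).erase v ⊆
          (G.edgesWithin (s.erase v)).neighborFinset u := by
        intro w hw
        simp only [Finset.mem_erase, mem_neighborFinset, edgesWithin_adj] at hw ⊢
        tauto
      have := Finset.card_le_card hsub
      split_ifs with hmem
      · have := Finset.pred_card_le_card_erase (s := (G.edgesWithin s).neighborFinset u) (a := v)
        omega
      · rw [Finset.erase_eq_of_notMem] at this
        · simpa using this
        · simpa [adj_comm] using hmem
  refine (Finset.sum_le_sum fun u _ => hpt u).trans ?_
  rw [Finset.sum_add_distrib, Finset.sum_add_distrib]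
  simp only [Finset.sum_ite_mem, Finset.sum_ite_eq', Finset.univ_inter, Finset.sum_const,
    card_neighborFinset_eq_degree, smul_eq_mul, mul_one, Finset.mem_univ, if_true]
  omega

/-- A graph on the vertex set `s` with large girth has few edges. -/
theorem sum_degree_edgesWithin_lt {t K : ℕ} (ht : t ≠ 0)
    (hK : (K = 1 ∧ ((2 * t : ℕ) : ℕ∞) < G.egirth) ∨
      (K = 2 ∧ ((2 * t + 1 : ℕ) : ℕ∞) < G.egirth))
    {s : Finset V} (hs : s.Nonempty) :
    (∑ v, ((G.edgesWithin s).degree v : ℝ)) <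
      s.card * ((s.card : ℝ) / K) ^ (1 / (t : ℝ)) + s.card := by
  have hK0 : (0 : ℝ) < K := by rcases hK with ⟨rfl, -⟩ | ⟨rfl, -⟩ <;> norm_num
  have hK2 : (K : ℝ) ≤ 2 := by rcases hK with ⟨rfl, -⟩ | ⟨rfl, -⟩ <;> norm_num
  have hg : ((2 * t : ℕ) : ℕ∞) < G.egirth := by
    rcases hK with ⟨-, h⟩ | ⟨-, h⟩
    · exact h
    · exact lt_of_le_of_lt (by exact_mod_cast by omega) h
  have ht0 : (0 : ℝ) < t := by exact_mod_cast Nat.pos_of_ne_zero ht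
  induction hN : s.card generalizing s with
  | zero => exact absurd (Finset.card_eq_zero.mp hN) hs.ne_empty
  | succ N ih =>
    by_cases hdeg : ∀ v ∈ s, 2 ≤ (G.edgesWithin s).degree v
    · have hgs := hg.trans_le (egirth_le_egirth_edgesWithin s)
      have hgs' : ((t + 1 : ℕ) : ℕ∞) < (G.edgesWithin s).egirth :=
        lt_of_le_of_lt (by exact_mod_cast by omega) hgs
      have hG : ∀ u v, (G.edgesWithin s).Adj u v → 2 ≤ (G.edgesWithin s).degree v :=
        fun u v huv => hdeg v huv.2.2
      have hsub : ∀ j u v, (G.edgesWithin s).Adj u v → (G.edgesWithin s).nbSphere j u v ⊆ s := by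
        intro j
        induction j with
        | zero => intro u v huv; simpa [nbSphere] using huv.2.2
        | succ j ihj =>
          intro u v huv x hx
          obtain ⟨w, -, hvw, hx⟩ := mem_nbSphere_succ.mp hx
          exact ihj v w hvw hx
      have hsub' : ∀ u v, (G.edgesWithin s).Adj u v →
          (G.edgesWithin s).nbSphere t u v ⊆ s.erase v := fun u v huv =>
        Finset.subset_erase.mpr ⟨hsub t u v huv, notMem_nbSphere_right huv ht hgs'⟩
      have hcard : ∀ u v, (G.edgesWithin s).Adj u v →
          (((G.edgesWithin s).nbSphere t u v).card : ℝ) ≤ N := fun u v huv => by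
        have := Finset.card_le_card (hsub' u v huv)
        rw [Finset.card_erase_of_mem huv.2.2, hN, Nat.add_sub_cancel] at this
        exact_mod_cast this
      have hN0 : 0 < N := by
        obtain ⟨v, hv⟩ := hs
        obtain ⟨w, hw⟩ := Finset.card_pos.mp
          (by rw [card_neighborFinset_eq_degree]; linarith [hdeg v hv] :
            0 < ((G.edgesWithin s).neighborFinset v).card)
        have hvw : (G.edgesWithin s).Adj v w := by simpa using hw
        have h1 := (nbSphere_nonempty hG t hvw).card_pos
        have h2 := hcard v w hvw
        exact_mod_cast lt_of_lt_of_le (by exact_mod_cast h1 : (0 : ℝ) < _) h2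
      -- Each sphere misses an end of the edge, hence `N` and not `N + 1`; this later makes the
      -- bound strict. For `K = 2` the spheres share these `N` vertices, and AM-GM applies.
      have hM : ∀ u v, (G.edgesWithin s).Adj u v →
          (((G.edgesWithin s).nbSphere t u v).card : ℝ) * ((G.edgesWithin s).nbSphere t v u).card ≤
            ((N : ℝ) / K) ^ 2 := by
        intro u v huv
        rcases hK with ⟨rfl, -⟩ | ⟨rfl, h⟩
        · rw [Nat.cast_one, div_one, sq]
          exact mul_le_mul (hcard u v huv) (hcard v u huv.symm) (by positivity) (by positivity)
        · have hdis := disjoint_nbSphere_swap (i := t) (j := t) huv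
            (lt_of_le_of_lt (by exact_mod_cast by omega)
              (h.trans_le (egirth_le_egirth_edgesWithin s)))
          have hsub2 : (G.edgesWithin s).nbSphere t u v ∪ (G.edgesWithin s).nbSphere t v u ⊆
              s.erase v := Finset.union_subset (hsub' u v huv)
            (Finset.subset_erase.mpr ⟨hsub t v u huv.symm, notMem_nbSphere_left huv.symm hgs'⟩)
          have := Finset.card_le_card hsub2
          rw [Finset.card_union_of_disjoint hdis, Finset.card_erase_of_mem huv.2.2, hN,
            Nat.add_sub_cancel] at this
          have : (((G.edgesWithin s).nbSphere t u v).card : ℝ) +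
            ((G.edgesWithin s).nbSphere t v u).card ≤ N := by exact_mod_cast this
          push_cast
          nlinarith [sq_nonneg ((((G.edgesWithin s).nbSphere t u v).card : ℝ) -
            ((G.edgesWithin s).nbSphere t v u).card)]
      have hmoore := averageDegree_sub_one_pow_le (G := G.edgesWithin s) hs (fun u v huv => huv.2.1) hdeg hgs
        (M := (N : ℝ) / K) (by positivity) hM
      rw [hN] at hmoore
      set D : ℝ := ∑ v, ((G.edgesWithin s).degree v : ℝ)
      have hlt : (D / ((N + 1 : ℕ) : ℝ) - 1) ^ t < ((N + 1 : ℕ) : ℝ) / K :=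
        lt_of_le_of_lt hmoore (by gcongr; omega)
      have hlt' : D / ((N + 1 : ℕ) : ℝ) - 1 < (((N + 1 : ℕ) : ℝ) / K) ^ (1 / (t : ℝ)) := by
        by_contra! hcon
        have := pow_le_pow_left₀ (by positivity) hcon t
        rw [← Real.rpow_natCast, ← Real.rpow_mul (by positivity), one_div,
          inv_mul_cancel₀ ht0.ne', Real.rpow_one] at this
        linarith
      have hc : (0 : ℝ) < ((N + 1 : ℕ) : ℝ) := by positivity
      rw [sub_lt_iff_lt_add, div_lt_iff₀ hc] at hlt'
      linarith
    · push Not at hdeg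
      obtain ⟨v, hv, hvd⟩ := hdeg
      rcases Nat.eq_zero_or_pos N with rfl | hNpos
      · obtain ⟨a, rfl⟩ := Finset.card_eq_one.mp hN
        have : ∀ v, (G.edgesWithin {a}).degree v = 0 := by
          intro v
          rw [← card_neighborFinset_eq_degree, Finset.card_eq_zero,
            Finset.eq_empty_iff_forall_notMem]
          intro w hw
          simp only [mem_neighborFinset, edgesWithin_adj, Finset.mem_singleton] at hw
          exact hw.1.ne (hw.2.1.trans hw.2.2.symm)
        simp only [this, Nat.cast_zero, Finset.sum_const_zero]
        positivity
      · have hcard : (s.erase v).card = N := by rw [Finset.card_erase_of_mem hv, hN]; simp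
        have h1 := ih (s := s.erase v) (Finset.card_pos.mp (by omega)) hcard
        have h2 : (∑ u, ((G.edgesWithin s).degree u : ℝ)) ≤
            ∑ u, ((G.edgesWithin (s.erase v)).degree u : ℝ) + 2 := by
          exact_mod_cast sum_degree_edgesWithin_le_erase (by omega : (G.edgesWithin s).degree v ≤ 1)
        have hN1 : (1 : ℝ) ≤ N := by exact_mod_cast hNpos
        -- As `N + 1 ≥ 2 ≥ K`, the bound grows by at least 2 from `N` to `N + 1`, which pays for the
        -- deleted edge.
        have h3 : (1 : ℝ) ≤ (((N + 1 : ℕ) : ℝ) / K) ^ (1 / (t : ℝ)) := by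
          apply Real.one_le_rpow _ (by positivity)
          rw [le_div_iff₀ hK0]
          push_cast
          linarith
        have h4 : ((N : ℝ) / K) ^ (1 / (t : ℝ)) ≤ (((N + 1 : ℕ) : ℝ) / K) ^ (1 / (t : ℝ)) := by
          gcongr
          omega
        have h5 := mul_le_mul_of_nonneg_left h4 (Nat.cast_nonneg (α := ℝ) N)
        push_cast at *
        linarith

end SimpleGraph

/-! ### The Feng–Yu bound for the `Q`-index. -/

namespace SimpleGraph

variable {V : Type*} [Fintype V] [DecidableEq V] {G : SimpleGraph V} [DecidableRel G.Adj]

/-- An eigenvalue of the signless Laplacian is at most the largest sum of the degree of a vertex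
and the average degree of its neighbours. -/
lemma exists_le_degree_add_of_hasEigenvalue (hdeg : ∀ v, 1 ≤ G.degree v) {μ : ℝ}
    (hμ : Module.End.HasEigenvalue (Matrix.toLin' G.signlessLapMatrix) μ) :
    ∃ v, μ ≤ G.degree v + (∑ u ∈ G.neighborFinset v, (G.degree u : ℝ)) / G.degree v := by
  obtain ⟨x, hx⟩ := hμ.exists_hasEigenvector
  have hd : ∀ v, (0 : ℝ) < G.degree v := fun v => by exact_mod_cast hdeg v
  obtain ⟨w, hw⟩ : ∃ w, x w ≠ 0 := by
    by_contra! h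
    exact hx.2 (funext h)
  have : Nonempty V := ⟨w⟩
  -- This weighting amounts to the row-sum bound for `D⁻¹ Q D`.
  obtain ⟨v, hv⟩ := Finite.exists_max fun v => |x v| / G.degree v
  have hpos : 0 < |x v| / G.degree v :=
    lt_of_lt_of_le (div_pos (abs_pos.mpr hw) (hd w)) (hv w)
  have heq : G.degree v * x v + ∑ u ∈ G.neighborFinset v, x u = μ * x v := by
    have := congrFun hx.apply_eq_smul v
    rwa [Matrix.toLin'_apply, signlessLapMatrix, Matrix.add_mulVec, Pi.add_apply,
      degMatrix_mulVec_apply, adjMatrix_mulVec_apply, Pi.smul_apply, smul_eq_mul] at this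
  refine ⟨v, ?_⟩
  have h1 : (μ - G.degree v) * |x v| ≤
      (|x v| / G.degree v) * ∑ u ∈ G.neighborFinset v, (G.degree u : ℝ) := by
    calc (μ - G.degree v) * |x v| ≤ |μ - G.degree v| * |x v| := by
          gcongr
          exact le_abs_self _
      _ = |∑ u ∈ G.neighborFinset v, x u| := by
          rw [← abs_mul]
          congr 1
          linarith
      _ ≤ ∑ u ∈ G.neighborFinset v, |x u| := Finset.abs_sum_le_sum_abs _ _
      _ ≤ ∑ u ∈ G.neighborFinset v, (|x v| / G.degree v) * (G.degree u : ℝ) :=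
          Finset.sum_le_sum fun u _ => (div_le_iff₀ (hd u)).mp (hv u)
      _ = _ := by rw [Finset.mul_sum]
  have hxv : 0 < |x v| := by
    have := mul_pos hpos (hd v)
    rwa [div_mul_cancel₀ _ (hd v).ne'] at this
  have h2 : (μ - G.degree v) * |x v| ≤
      ((∑ u ∈ G.neighborFinset v, (G.degree u : ℝ)) / G.degree v) * |x v| := by
    refine h1.trans (le_of_eq ?_)
    ring
  linarith [le_of_mul_le_mul_right h2 hxv]

/-- The neighbour sum `S` is at most `d (n - 1)`, and at most `D - (n - 1)` since non-neighbours
have degree at least 1. The two bounds cross at `d = D/(n-1) - 1`, where the cases split; above it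
the claim is `(d - D/(n-1) + 1)(n - 1 - d) ≥ 0`. -/
lemma degree_add_average_le (hdeg : ∀ v, 1 ≤ G.degree v) (v : V) :
    G.degree v + (∑ u ∈ G.neighborFinset v, (G.degree u : ℝ)) / G.degree v ≤
      (∑ u, (G.degree u : ℝ)) / ((Fintype.card V : ℝ) - 1) + ((Fintype.card V : ℝ) - 2) := by
  set n : ℝ := (Fintype.card V : ℝ) with hn
  set D : ℝ := ∑ u, (G.degree u : ℝ) with hD
  set d : ℝ := (G.degree v : ℝ) with hd
  set S : ℝ := ∑ u ∈ G.neighborFinset v, (G.degree u : ℝ) with hS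
  have hle : ∀ u, (G.degree u : ℝ) ≤ n - 1 := fun u => by
    have : G.degree u + 1 ≤ Fintype.card V := G.degree_lt_card_verts u
    rw [le_sub_iff_add_le, hn]
    exact_mod_cast this
  have hd1 : 1 ≤ d := by rw [hd]; exact_mod_cast hdeg v
  have hdn : d ≤ n - 1 := hle v
  have hS1 : S ≤ d * (n - 1) := by
    rw [hS, hd, ← card_neighborFinset_eq_degree, ← nsmul_eq_mul]
    exact Finset.sum_le_card_nsmul _ _ _ fun u _ => hle u
  have hS2 : S ≤ D - (n - 1) := by
    have hcompl : n - d ≤ ∑ u ∈ (G.neighborFinset v)ᶜ, (G.degree u : ℝ) - (d - 1) := by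
      have hvm : v ∈ (G.neighborFinset v)ᶜ := by simp
      rw [← Finset.sum_erase_add _ _ hvm]
      have h1 : (((G.neighborFinset v)ᶜ.erase v).card : ℝ) ≤
          ∑ u ∈ (G.neighborFinset v)ᶜ.erase v, (G.degree u : ℝ) := by
        rw [Finset.card_eq_sum_ones, Nat.cast_sum]
        exact Finset.sum_le_sum fun u _ => by exact_mod_cast hdeg u
      have h2 : (((G.neighborFinset v)ᶜ.erase v).card : ℝ) = n - d - 1 := by
        rw [Finset.card_erase_of_mem hvm, Nat.cast_pred (Finset.card_pos.mpr ⟨v, hvm⟩),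
          Finset.card_compl, Nat.cast_sub (Finset.card_le_univ _), card_neighborFinset_eq_degree]
      linarith
    have := Finset.sum_add_sum_compl (G.neighborFinset v) fun u => (G.degree u : ℝ)
    linarith
  have hn1 : 0 < n - 1 := by linarith
  have hd0 : 0 < d := by linarith
  rcases le_or_gt (D / (n - 1) - 1) d with hcase | hcase
  · have h1 : S / d ≤ (D - (n - 1)) / d := by gcongr
    have h2 : (D - (n - 1)) / d ≤ D / (n - 1) - 1 + (n - 1 - d) := by
      rw [div_le_iff₀ hd0]
      have h3 : D = (D / (n - 1)) * (n - 1) := by field_simp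
      have h4 := mul_nonneg (sub_nonneg.mpr hcase) (sub_nonneg.mpr hdn)
      nlinarith
    linarith
  · have h1 : S / d ≤ n - 1 := by rw [div_le_iff₀ hd0]; linarith
    linarith

/-- The Feng–Yu bound for the largest eigenvalue of the signless Laplacian. -/
theorem qIndex_le [Nonempty V] (hdeg : ∀ v, 1 ≤ G.degree v) :
    G.qIndex ≤
      (∑ u, (G.degree u : ℝ)) / ((Fintype.card V : ℝ) - 1) + ((Fintype.card V : ℝ) - 2) := by
  refine Real.sSup_le (fun μ hμ => ?_) ?_
  · obtain ⟨v, hv⟩ := exists_le_degree_add_of_hasEigenvalue hdeg hμ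
    exact hv.trans (degree_add_average_le hdeg v)
  -- `Real.sSup_le` also asks for a nonnegative bound.
  · exact le_trans (by positivity) (degree_add_average_le hdeg (Classical.arbitrary V))

end SimpleGraph

/-! ### Combining the estimates across a cut. -/

namespace SimpleGraph

/-- Spreading two numbers apart increases the sum of their `p`-th powers. -/
lemma rpow_add_rpow_le {p a b L M : ℝ} (hp : 1 ≤ p) (hL : 0 ≤ L) (ha : L ≤ a) (haM : a ≤ M)
    (hsum : a + b = L + M) : a ^ p + b ^ p ≤ L ^ p + M ^ p := by
  have hb : b = L + M - a := by linarith
  rcases eq_or_lt_of_le (ha.trans haM) with h | h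
  · have h1 : a = L := by linarith
    have h2 : b = M := by linarith
    rw [h1, h2]
  · have hc := convexOn_rpow hp
    have hML : 0 < M - L := by linarith
    set θ := (M - a) / (M - L) with hθ
    have hθ0 : 0 ≤ θ := div_nonneg (by linarith) hML.le
    have hθ1 : θ ≤ 1 := (div_le_one hML).mpr (by linarith)
    have hθm : θ * (M - L) = M - a := div_mul_cancel₀ _ hML.ne'
    have h1 := hc.2 (x := L) (y := M) hL (hL.trans h.le) hθ0 (sub_nonneg.mpr hθ1) (by ring)
    have h2 := hc.2 (x := M) (y := L) (hL.trans h.le) hL hθ0 (sub_nonneg.mpr hθ1) (by ring)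
    simp only [smul_eq_mul] at h1 h2
    rw [show θ * L + (1 - θ) * M = a by linarith] at h1
    rw [show θ * M + (1 - θ) * L = b by rw [hb]; linarith] at h2
    linarith

variable {V : Type*} [Fintype V] [DecidableEq V] {G : SimpleGraph V} [DecidableRel G.Adj]

/-- A union of components of `G - C`, with `C` smaller than the minimum degree, has at least
`ν(δ, g, κ)` vertices if `#C ≤ κ`. -/
lemma nuGirth_le_card (hconn : G.Connected) {δ g κ : ℕ} (hδ : ∀ v, δ ≤ G.degree v)
    (hδ2 : 2 ≤ δ) (hκ : κ < δ) (hg3 : 3 ≤ g) (hg : (g : ℕ∞) ≤ G.egirth) {X C : Finset V}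
    (hC : C.card ≤ κ) (hX : ∀ u ∈ X, ∀ v, G.Adj u v → v ∉ C → v ∈ X)
    (hne : X.Nonempty) (hout : ∃ y, y ∉ X ∧ y ∉ C) : nuGirth δ g κ ≤ X.card := by
  set t := (g - 1) / 2 with ht
  have hcast : ((∑ i ∈ Finset.range t, (δ - 1) ^ i : ℕ) : ℤ) =
      ∑ i ∈ Finset.range t, ((δ : ℤ) - 1) ^ i := by
    push_cast [Nat.cast_sub (by omega : 1 ≤ δ)]
    rfl
  set β := ∑ i ∈ Finset.range t, (δ - 1) ^ i with hβ
  have hCβ : (C.card : ℤ) * β ≤ κ * β := by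
    exact_mod_cast Nat.mul_le_mul_right β hC
  rw [nuGirth, ← ht, ← hcast]
  split_ifs with hodd hδ3
  · have := one_add_mul_sum_le_card_of_cut hX hne hδ (t := t)
      (lt_of_lt_of_le (by exact_mod_cast by omega) hg)
    rw [← hβ] at this
    zify at this
    linarith
  · obtain ⟨x, hx⟩ := hne
    obtain ⟨y, hy, hyC⟩ : ∃ y ∈ G.neighborFinset x, y ∉ C := by
      apply Finset.exists_mem_notMem_of_card_lt_card
      rw [card_neighborFinset_eq_degree]
      exact lt_of_le_of_lt hC (hκ.trans_le (hδ x))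
    have hxy : G.Adj x y := by simpa using hy
    have heven : Even g := Nat.not_odd_iff_even.mp hodd
    obtain ⟨r, hr⟩ := heven
    have := two_add_mul_sum_le_card_of_cut hX hx (hX x hx y hxy hyC) hxy hδ (t := t)
      (lt_of_lt_of_le (by exact_mod_cast by omega) hg)
    rw [← hβ] at this
    zify at this
    rw [Nat.cast_sub (by omega)] at this
    push_cast at this
    linarith
  · have hδeq : δ = 2 := by omega
    obtain ⟨x, hx⟩ := hne
    obtain ⟨y', hy', hyC'⟩ := hout
    -- Connectedness yields an edge from `X` into `C`, and `C.card ≤ κ < 2` makes its end the whole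
    -- cut.
    obtain ⟨d, hd, hd1, hd2⟩ := (hconn.preconnected x y').some.exists_boundary_dart (X : Set V)
      (by simpa using hx) (by simpa using hy')
    have hzC : d.snd ∈ C := by
      by_contra h
      exact hd2 (by simpa using hX _ (by simpa using hd1) _ d.adj h)
    have hCz : C = {d.snd} := by
      refine (Finset.eq_of_subset_of_card_le (Finset.singleton_subset_iff.mpr hzC) ?_).symm
      rw [Finset.card_singleton]
      omega
    have := le_card_add_one_of_cut_vertex (X := X) (z := d.snd) (by simpa using hd2)
      (fun u hu v huv hv => hX u hu v huv (by rw [hCz]; simpa using hv))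
      (y := d.fst) (by simpa using hd1) d.adj (fun v => hδeq ▸ hδ v) (by omega) hg
    have heven : Even g := Nat.not_odd_iff_even.mp hodd
    obtain ⟨r, hr⟩ := heven
    zify at this
    omega

/-- Every edge lies within one of the two sides of a separation. -/
lemma sum_degree_le_of_separation {S T : Finset V}
    (hST : ∀ u v, G.Adj u v → (u ∈ S ∧ v ∈ S) ∨ (u ∈ T ∧ v ∈ T)) :
    (∑ v, (G.degree v : ℝ)) ≤
      ∑ v, ((G.edgesWithin S).degree v : ℝ) + ∑ v, ((G.edgesWithin T).degree v : ℝ) := by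
  rw [← Finset.sum_add_distrib]
  refine Finset.sum_le_sum fun v _ => ?_
  simp only [← card_neighborFinset_eq_degree]
  norm_cast
  refine le_trans (Finset.card_le_card ?_) (Finset.card_union_le _ _)
  intro w hw
  have hvw : G.Adj v w := by simpa using hw
  simp only [Finset.mem_union, mem_neighborFinset, edgesWithin_adj]
  have := hST v w hvw
  tauto

/-- A cut of `G` into two nonempty sides `X` and `Y` bounds the degree sum. -/
lemma sum_degree_lt_of_cut {t K : ℕ} (ht : t ≠ 0)
    (hK : (K = 1 ∧ ((2 * t : ℕ) : ℕ∞) < G.egirth) ∨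
      (K = 2 ∧ ((2 * t + 1 : ℕ) : ℕ∞) < G.egirth))
    {X C Y : Finset V} (hXC : Disjoint X C) (hYC : Disjoint Y C) (hXY : Disjoint X Y)
    (huniv : ∀ v, v ∈ X ∨ v ∈ C ∨ v ∈ Y) (hX : X.Nonempty) (hY : Y.Nonempty)
    (hadj : ∀ u ∈ X, ∀ v ∈ Y, ¬ G.Adj u v) {ν κ : ℝ} (hν0 : 0 ≤ ν) (hνX : ν ≤ X.card)
    (hνY : ν ≤ Y.card) (hC : C.card ≤ κ) :
    (∑ v, (G.degree v : ℝ)) <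
      ((ν + κ) ^ (1 + 1 / (t : ℝ)) + ((Fintype.card V : ℝ) - ν) ^ (1 + 1 / (t : ℝ))) /
        (K : ℝ) ^ (1 / (t : ℝ)) + (Fintype.card V : ℝ) + κ := by
  have hK0 : (0 : ℝ) < K := by rcases hK with ⟨rfl, -⟩ | ⟨rfl, -⟩ <;> norm_num
  have hsep := sum_degree_le_of_separation (G := G) (S := X ∪ C) (T := Y ∪ C) (by
    intro u v huv
    simp only [Finset.mem_union]
    have h1 := huniv u
    have h2 := huniv v
    have h3 := fun hu hv => hadj u hu v hv huv
    have h4 := fun hv hu => hadj v hv u hu huv.symm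
    tauto)
  have hSX := sum_degree_edgesWithin_lt ht hK (s := X ∪ C) (hX.mono Finset.subset_union_left)
  have hSY := sum_degree_edgesWithin_lt ht hK (s := Y ∪ C) (hY.mono Finset.subset_union_left)
  have hcard : (X.card : ℝ) + C.card + Y.card = Fintype.card V := by
    have : X ∪ C ∪ Y = Finset.univ := by
      ext v
      have := huniv v
      simp only [Finset.mem_union, Finset.mem_univ, iff_true]
      tauto
    rw [← Finset.card_univ, ← this, Finset.card_union_of_disjoint, Finset.card_union_of_disjoint hXC]
    · push_cast; rfl
    · exact Finset.disjoint_union_left.mpr ⟨hXY, hYC.symm⟩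
  rw [Finset.card_union_of_disjoint hXC, Nat.cast_add] at hSX
  rw [Finset.card_union_of_disjoint hYC, Nat.cast_add] at hSY
  have ht0 : (0 : ℝ) ≤ 1 / (t : ℝ) := by positivity
  have hform : ∀ N : ℝ, 0 ≤ N → N * (N / K) ^ (1 / (t : ℝ)) =
      N ^ (1 + 1 / (t : ℝ)) / (K : ℝ) ^ (1 / (t : ℝ)) := by
    intro N hN
    rw [Real.div_rpow hN hK0.le, Real.rpow_add_of_nonneg hN zero_le_one ht0, Real.rpow_one,
      mul_div_assoc]
  rw [hform _ (by positivity)] at hSX hSY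
  -- The part sizes add up to `n + C.card`, so the spreading uses the true `C.card`; only afterwards
  -- is it enlarged to `κ`.
  have hmaj := rpow_add_rpow_le (p := 1 + 1 / (t : ℝ)) (a := X.card + C.card)
    (b := Y.card + C.card) (L := ν + C.card) (M := Fintype.card V - ν) (by linarith)
    (by positivity) (by linarith) (by linarith) (by linarith)
  have hmono : (ν + C.card) ^ (1 + 1 / (t : ℝ)) ≤ (ν + κ) ^ (1 + 1 / (t : ℝ)) :=
    Real.rpow_le_rpow (by positivity) (by linarith) (by linarith)
  have hKt : (0 : ℝ) < (K : ℝ) ^ (1 / (t : ℝ)) := Real.rpow_pos_of_pos hK0 _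
  have hdiv := div_le_div_of_nonneg_right (hmaj.trans (add_le_add_left hmono _)) hKt.le
  rw [add_div] at hdiv
  linarith

/-- Needed because `sInf ∅ = 0` in `ℕ`; all vertices but one form a cut. -/
lemma nonempty_setOf_isVertexCut_card [Nonempty V] (G : SimpleGraph V) :
    {c | ∃ C : Finset V, G.IsVertexCut C ∧ C.card = c}.Nonempty := by
  refine ⟨_, Finset.univ.erase (Classical.arbitrary V), Or.inr ?_, rfl⟩
  simp

/-- A vertex-cut smaller than the minimum degree separates the remaining vertices into two
nonempty sides. -/
lemma IsVertexCut.exists_separation {C : Finset V} (hcut : G.IsVertexCut C) {δ : ℕ}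
    (hδ : ∀ v, δ ≤ G.degree v) (hC : C.card < δ) :
    ∃ X Y : Finset V, X.Nonempty ∧ Y.Nonempty ∧ Disjoint X C ∧ Disjoint Y C ∧ Disjoint X Y ∧
      (∀ v, v ∈ X ∨ v ∈ C ∨ v ∈ Y) ∧ ∀ u ∈ X, ∀ v ∈ Y, ¬ G.Adj u v := by
  classical
  rcases hcut with hcut | hcut
  · rw [Preconnected] at hcut
    push Not at hcut
    obtain ⟨a, b, hab⟩ := hcut
    have ha : (a : V) ∉ C := a.2
    have hb : (b : V) ∉ C := b.2
    set X : Finset V := Finset.univ.filter fun v =>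
      ∃ hv : v ∉ C, (G.induce {v | v ∉ C}).Reachable a ⟨v, hv⟩ with hX
    have hmem : ∀ {v}, v ∈ X ↔ ∃ hv : v ∉ C, (G.induce {v | v ∉ C}).Reachable a ⟨v, hv⟩ := by
      simp [hX]
    refine ⟨X, (X ∪ C)ᶜ, ⟨a, hmem.mpr ⟨ha, Reachable.refl _⟩⟩, ⟨b, ?_⟩, ?_, ?_, ?_, ?_, ?_⟩
    · simp only [Finset.mem_compl, Finset.mem_union, not_or]
      exact ⟨fun h => hab (hmem.mp h).2, hb⟩
    · exact Finset.disjoint_left.mpr fun v hv => (hmem.mp hv).1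
    · exact Finset.disjoint_left.mpr fun v hv hvC => by simp [hvC] at hv
    · exact Finset.disjoint_left.mpr fun v hv hvC => by simp [hv] at hvC
    · intro v
      simp only [Finset.mem_compl, Finset.mem_union]
      tauto
    · intro u hu v hv huv
      simp only [Finset.mem_compl, Finset.mem_union, not_or] at hv
      obtain ⟨huC, hr⟩ := hmem.mp hu
      refine hv.1 (hmem.mpr ⟨hv.2, hr.trans (Adj.reachable ?_)⟩)
      exact huv
  -- A single remaining vertex would give `n = C.card + 1 ≤ δ`, but degrees are below `n`.
  · exfalso
    have h1 : Fintype.card V = C.card + 1 := by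
      rw [Nat.card_eq_fintype_card, Fintype.card_subtype_compl] at hcut
      simp only [Fintype.card_coe] at hcut
      omega
    obtain ⟨⟨v, -⟩⟩ : Nonempty {v // v ∉ C} :=
      (Nat.card_pos_iff.mp (by rw [hcut]; exact one_pos)).1
    have := hδ v
    have := G.degree_lt_card_verts v
    omega

end SimpleGraph

/-! ### The main theorem. -/

theorem theorem3p2 {V : Type*} [Fintype V] [DecidableEq V] (G : SimpleGraph V)
    [DecidableRel G.Adj] (n δ g k t : ℕ) (ν : ℝ)
    (hconn : G.Connected)
    (hn : Fintype.card V = n)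
    (hδ : G.minDegree = δ) (hkδ : k ≤ δ) (hk : 2 ≤ k)
    (hg : G.egirth = g) (hg3 : 3 ≤ g)
    (ht : t = (g - 1) / 2)
    (hν : ν = SimpleGraph.nuGirth δ g (k - 1))
    (hq : (if Odd g then
          ((ν + k - 1) ^ (1 + 1 / (t : ℝ)) + ((n : ℝ) - ν) ^ (1 + 1 / (t : ℝ))) / ((n : ℝ) - 1)
            + (k : ℝ) / ((n : ℝ) - 1) + ((n : ℝ) - 1)
        else
          ((ν + k - 1) ^ (1 + 1 / (t : ℝ)) + ((n : ℝ) - ν) ^ (1 + 1 / (t : ℝ)))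
              / ((2 : ℝ) ^ (1 / (t : ℝ)) * ((n : ℝ) - 1))
            + (k : ℝ) / ((n : ℝ) - 1) + ((n : ℝ) - 1))
      ≤ G.qIndex) :
    G.IsKVertexConnected k := by
  have : Nonempty V := hconn.nonempty
  have hdeg : ∀ v, δ ≤ G.degree v := fun v => hδ ▸ G.minDegree_le_degree v
  refine le_csInf G.nonempty_setOf_isVertexCut_card ?_
  rintro c ⟨C, hcut, rfl⟩
  by_contra! hCk
  obtain ⟨X, Y, hX, hY, hXC, hYC, hXY, huniv, hadj⟩ := hcut.exists_separation hdeg (by omega)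
  have hadj' : ∀ u ∈ Y, ∀ v ∈ X, ¬ G.Adj u v := fun u hu v hv h => hadj v hv u hu h.symm
  have ht0 : t ≠ 0 := by omega
  have hside : ∀ {A B : Finset V}, A.Nonempty → B.Nonempty → Disjoint B C → Disjoint A B →
      (∀ v, v ∈ A ∨ v ∈ C ∨ v ∈ B) → (∀ u ∈ A, ∀ v ∈ B, ¬ G.Adj u v) →
      ν ≤ A.card := by
    intro A B hA ⟨b, hb⟩ hBC hAB hu hnadj
    have := SimpleGraph.nuGirth_le_card hconn hdeg (g := g) (κ := k - 1) (by omega) (by omega) hg3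
      hg.ge (X := A) (C := C) (by omega)
      (fun u huA v huv hvC => by
        rcases hu v with h | h | h
        · exact h
        · exact absurd h hvC
        · exact absurd huv (hnadj u huA v h))
      hA ⟨b, Finset.disjoint_right.mp hAB hb, Finset.disjoint_left.mp hBC hb⟩
    rw [hν]
    exact_mod_cast this
  have hν0 : 0 ≤ ν := by
    have hδ1 : (0 : ℤ) ≤ (δ : ℤ) - 1 := by omega
    have hsum : (0 : ℤ) ≤ ∑ i ∈ Finset.range ((g - 1) / 2), ((δ : ℤ) - 1) ^ i :=
      Finset.sum_nonneg fun i _ => pow_nonneg hδ1 i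
    rw [hν]
    norm_cast
    rw [SimpleGraph.nuGirth]
    split_ifs with h1 h2
    · have := mul_nonneg (by omega : (0 : ℤ) ≤ (δ : ℤ) - (k - 1 : ℕ)) hsum
      linarith
    · have := mul_nonneg (by omega : (0 : ℤ) ≤ 2 * (δ : ℤ) - 2 - (k - 1 : ℕ)) hsum
      linarith
    · positivity
  have hνX := hside hX hY hYC hXY huniv hadj
  have hνY := hside hY hX hXC hXY.symm (fun v => by rcases huniv v with h | h | h <;> simp [h]) hadj'
  have hbound : ∀ K : ℕ, ((K = 1 ∧ ((2 * t : ℕ) : ℕ∞) < G.egirth) ∨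
      (K = 2 ∧ ((2 * t + 1 : ℕ) : ℕ∞) < G.egirth)) →
      G.qIndex < ((ν + k - 1) ^ (1 + 1 / (t : ℝ)) + ((n : ℝ) - ν) ^ (1 + 1 / (t : ℝ))) /
        ((K : ℝ) ^ (1 / (t : ℝ)) * ((n : ℝ) - 1)) + (k : ℝ) / ((n : ℝ) - 1) + ((n : ℝ) - 1) := by
    intro K hK
    have h1 := SimpleGraph.sum_degree_lt_of_cut ht0 hK hXC hYC hXY huniv hX hY hadj hν0 hνX hνY
      (κ := (k : ℝ) - 1) (by rw [le_sub_iff_add_le]; exact_mod_cast hCk)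
    have h2 := SimpleGraph.qIndex_le (G := G) fun v => le_trans (by omega) (hdeg v)
    rw [hn, ← add_sub_assoc] at h1
    rw [hn] at h2
    have hn1 : (0 : ℝ) < (n : ℝ) - 1 := by
      have := hdeg (Classical.arbitrary V)
      have := G.degree_lt_card_verts (Classical.arbitrary V)
      rw [sub_pos]
      exact_mod_cast (by omega : 1 < n)
    have h3 := div_lt_div_of_pos_right h1 hn1
    rw [← div_div]
    refine lt_of_lt_of_eq (h2.trans_lt (add_lt_add_left h3 _)) ?_
    -- The term `(n - 1)/(n - 1) = 1` turns `n - 2` into `n - 1`.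
    have h4 : ∀ A : ℝ, (A + n + k - 1) / ((n : ℝ) - 1) + ((n : ℝ) - 2) =
        A / ((n : ℝ) - 1) + k / ((n : ℝ) - 1) + ((n : ℝ) - 1) := fun A => by
      field_simp
      ring
    rw [h4, add_sub_assoc ν]
  split_ifs at hq with hodd
  · have := hbound 1 (Or.inl ⟨rfl, by rw [hg]; exact_mod_cast by omega⟩)
    rw [Nat.cast_one, Real.one_rpow, one_mul] at this
    linarith
  · obtain ⟨r, hr⟩ := Nat.not_odd_iff_even.mp hodd
    have := hbound 2 (Or.inr ⟨rfl, by rw [hg]; exact_mod_cast by omega⟩)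
    rw [Nat.cast_ofNat] at this
    linarith
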